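/- Let $X$ be a quandle with right operation $*$. Let $\mathrm{Inn}(X)$ be the group generated by the bijections $\bullet * y$ $(y\in X)$, acting on $X$ from the right, and assume that $X$ is connected, i.e. this action is transitive. Fix $x_0\in X$ and let $\mathrm{Stab}(x_0)\subset \mathrm{Inn}(X)$ be its stabilizer. Let $\mathrm{As}(X)=\langle e_x\ (x\in X)\mid e_xe_y=e_ye_{x*y}\rangle$, acting on $X$ by $x\cdot e_y=x*y$, let $\psi:\mathrm{As}(X)\to\mathrm{Inn}(X)$ be the surjection $e_x\mapsto \bullet * x$, and let $\widetilde{\mathrm{Stab}}(x_0)\subset \mathrm{As}(X)$ be the stabilizer of $x_0$. Put $$\mathrm{Type}(X)=\min\{n\ge 1\mid (\cdots(x*\underbrace{y)\cdots)*y}_{n}=x\ \text{for all } x,y\in X\}\in\mathbb N\cup\{\infty\}.$$ Let $H_2^Q(X;\mathbb Z)$ be the quotient of $\mathrm{Ker}(\partial_2:\mathbb Z\langle X^2\rangle\to\mathbb Z\langle X\rangle)$ by the subgroup generated by $\mathrm{Im}(\partial_3)$ and the elements $(a,a)$, $a\in X$, where $\partial_2(x,y)=(x)-(x*y)$ and $\partial_3(x,y,z)=(x,z)-(x*y,z)-(x,y)+(x*z,y*z)$.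 Let $H_2(\mathrm{Inn}(X),\mathrm{Stab}(x_0);\mathbb Z)$ be the relative group homology, i.e. the homology of the mapping cone of the map of inhomogeneous chain complexes induced by $\mathrm{Stab}(x_0)\subset\mathrm{Inn}(X)$. For an abelian group $M$ and a prime $\ell$, $M_{(\ell)}$ denotes the localization of $M$ at the prime ideal $(\ell)$ of $\mathbb Z$. Then there is a homomorphism $$\mathcal T_*:\mathrm{Ker}\bigl(H_2(\mathrm{Inn}(X),\mathrm{Stab}(x_0);\mathbb Z)\to H_1(\mathrm{Stab}(x_0);\mathbb Z)\bigr)\longrightarrow H_2^Q(X;\mathbb Z)$$ whose composite with the natural map from $H_2(\mathrm{Inn}(X);\mathbb Z)$ onto this kernel is $$H_2(\mathrm{Inn}(X);\mathbb Z)\to \mathrm{Ker}(\psi)\to H_1(\widetilde{\mathrm{Stab}}(x_0);\mathbb Z)\to H_2^Q(X;\mathbb Z).$$ Here the first map is the connecting map of the central extension $\psi$, $\bigl[\sum_i n_i(g_i,h_i)\bigr]\mapsto\prod_i\bigl(s(g_i)s(h_i)s(g_ih_i)^{-1}\bigr)^{n_i}$ for any set-theoretic section $s$ of $\psi$; the second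 is induced by the inclusion; and the third sends the class of $e_{x_1}^{\epsilon_1}\cdots e_{x_n}^{\epsilon_n}$ $(\epsilon_j=\pm1)$ to the class of $\sum_{j=1}^n\epsilon_j (y_j,x_j)$, where $y_j=x_0\cdot e_{x_1}^{\epsilon_1}\cdots e_{x_{j-1}}^{\epsilon_{j-1}}$ if $\epsilon_j=1$ and $y_j=x_0\cdot e_{x_1}^{\epsilon_1}\cdots e_{x_{j}}^{\epsilon_{j}}$ if $\epsilon_j=-1$. Moreover, let $\ell$ be any prime number such that $\mathrm{Type}(X)$ is finite and coprime to $\ell$, and such that $H_1(\mathrm{Stab}(x_0);\mathbb Z)_{(\ell)}=0$. Then the localization of $\mathcal T_*$ at $\ell$ yields an isomorphism $$H_2(\mathrm{Inn}(X),\mathrm{Stab}(x_0);\mathbb Z)_{(\ell)}\ \cong\ H_2^Q(X;\mathbb Z)_{(\ell)};$$ that is, there is a $\mathbb Z_{(\ell)}$-linear isomorphism between these modules whose composite with the localization of the inclusion $\mathrm{Ker}\bigl(H_2(\mathrm{Inn}(X),\mathrm{Stab}(x_0);\mathbb Z)\to H_1(\mathrm{Stab}(x_0);\mathbb Z)\bigr)\subset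 H_2(\mathrm{Inn}(X),\mathrm{Stab}(x_0);\mathbb Z)$ is $(\mathcal T_*)_{(\ell)}$. -/

import Mathlib

noncomputable section

namespace QuandleSchur

open Finsupp

universe u

/-! ## Low-degree group homology with trivial integer coefficients

The inhomogeneous (bar) complex `C_n(G) = ℤ[Gⁿ]`, in degrees `n ≤ 3`. For trivial coefficients
the differential `C_1(G) → C_0(G) = ℤ` is zero. -/

section GroupHomology

variable (G : Type u) [Group G]

/-- `∂(g, h) = (h) - (gh) + (g)`. -/
def barD2 : (G × G →₀ ℤ) →ₗ[ℤ] (G →₀ ℤ) :=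
  linearCombination ℤ fun g => single g.2 1 - single (g.1 * g.2) 1 + single g.1 1

/-- `∂(g, h, k) = (h, k) - (gh, k) + (g, hk) - (g, h)`. -/
def barD3 : (G × G × G →₀ ℤ) →ₗ[ℤ] (G × G →₀ ℤ) :=
  linearCombination ℤ fun g =>
    single (g.2.1, g.2.2) 1 - single (g.1 * g.2.1, g.2.2) 1
      + single (g.1, g.2.1 * g.2.2) 1 - single (g.1, g.2.1) 1

/-- `H_1(G; ℤ)`: since `∂ : C_1(G) → C_0(G)` vanishes, every 1-chain is a cycle. -/
abbrev H1 : Type u := (G →₀ ℤ) ⧸ LinearMap.range (barD2 G)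

variable {G} (K : Subgroup G)

/-- The map `C_1(K) → C_1(G)` induced by the inclusion. -/
def incl1 : (K →₀ ℤ) →ₗ[ℤ] (G →₀ ℤ) := lmapDomain ℤ ℤ fun k : K => (k : G)

/-- The map `C_2(K) → C_2(G)` induced by the inclusion. -/
def incl2 : (K × K →₀ ℤ) →ₗ[ℤ] (G × G →₀ ℤ) :=
  lmapDomain ℤ ℤ fun k : K × K => ((k.1 : G), (k.2 : G))

/-- The relative complex is the mapping cone `C_n(G, K) = C_n(G) ⊕ C_{n-1}(K)` with differential
`∂(a, b) = (∂ a + b, -∂ b)`. This is the differential out of `C_2(G, K)`; its component in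
`C_0(K)` is `-∂ b = 0`, so only the component in `C_1(G)` is recorded. -/
def relD2 : (G × G →₀ ℤ) × (K →₀ ℤ) →ₗ[ℤ] (G →₀ ℤ) :=
  (barD2 G).coprod (incl1 K)

/-- The differential `∂(a, b) = (∂ a + b, -∂ b)` from `C_3(G, K)` to `C_2(G, K)`. -/
def relD3 : (G × G × G →₀ ℤ) × (K × K →₀ ℤ) →ₗ[ℤ] (G × G →₀ ℤ) × (K →₀ ℤ) :=
  ((barD3 G).coprod (incl2 K)).prod (-(barD2 K ∘ₗ LinearMap.snd ℤ _ _))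

/-- The relative homology `H_2(G, K; ℤ)`. -/
abbrev H2Rel : Type u :=
  LinearMap.ker (relD2 K) ⧸ (LinearMap.range (relD3 K)).comap (LinearMap.ker (relD2 K)).subtype

/-- The connecting map `H_2(G, K; ℤ) → H_1(K; ℤ)`, `[(a, b)] ↦ [b]`. -/
def connecting : H2Rel K →ₗ[ℤ] H1 K :=
  Submodule.liftQ _
    ((LinearMap.range (barD2 K)).mkQ ∘ₗ LinearMap.snd ℤ _ _ ∘ₗ (LinearMap.ker (relD2 K)).subtype)
    (by
      rintro ⟨z, hz⟩ ⟨w, hw⟩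
      have hw' : relD3 K w = z := hw
      subst hw'
      rw [LinearMap.mem_ker]
      refine (Submodule.Quotient.mk_eq_zero _).2 ⟨-w.2, ?_⟩
      simp [relD3])

/-- The natural map from the absolute 2-cycles of `G` to
`Ker (H_2(G, K; ℤ) → H_1(K; ℤ))`, sending `z` to the class of `(z, 0)`. It induces the map
from `H_2(G; ℤ)` of the long exact sequence of the pair. -/
def absToRel : LinearMap.ker (barD2 G) →ₗ[ℤ] LinearMap.ker (connecting K) :=
  LinearMap.codRestrict _
    (Submodule.mkQ _ ∘ₗ
      LinearMap.codRestrict (LinearMap.ker (relD2 K))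
        (LinearMap.inl ℤ _ _ ∘ₗ (LinearMap.ker (barD2 G)).subtype)
        (fun z => by
          have hz : barD2 G z.1 = 0 := z.2
          simp [relD2, hz]))
    (fun z => by
      rw [LinearMap.mem_ker]
      exact (Submodule.Quotient.mk_eq_zero _).2 (Submodule.zero_mem _))

end GroupHomology

/-! ## Quandles

Mathlib writes a quandle operation as a left action `y ◃ x`; the right operation `x * y` is
`y ◃ x`. Groups acting on the right on `X` are taken inside the opposite `(Equiv.Perm X)ᵐᵒᵖ`
of the permutation group, in which `op σ * op τ` is "first `σ`, then `τ`". -/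

section Quandle

variable (X : Type u) [Quandle X]

variable {X} in
/-- The right quandle operation `x * y`. -/
abbrev star (x y : X) : X := Shelf.act y x

variable {X} in
/-- The right translation `• * y`, as an element of the group of permutations acting from the
right. -/
def rightTranslation (y : X) : (Equiv.Perm X)ᵐᵒᵖ := MulOpposite.op (Rack.act' y)

/-- The inner automorphism group, generated by the right translations. -/
def Inn : Subgroup (Equiv.Perm X)ᵐᵒᵖ := Subgroup.closure (Set.range (rightTranslation (X := X)))

/-- `X` is connected: the right action of `Inn X` on `X` is transitive. -/
def IsConnected : Prop := ∀ x y : X, ∃ g ∈ Inn X, g.unop x = y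

variable {X} in
/-- The stabilizer of `x` in `Inn X`. -/
def Stab (x : X) : Subgroup (Inn X) :=
  ((MulAction.stabilizer (Equiv.Perm X) x).op).subgroupOf (Inn X)

/-- The type of `X`: the least `n ≥ 1` with `(⋯(x * y)⋯) * y = x` (`n` times) for all `x, y`;
it is `⊤` if there is no such `n`. -/
def quandleType : ℕ∞ :=
  ⨅ (n : ℕ) (_ : 0 < n ∧ ∀ x y : X, (fun z => star z y)^[n] x = x), (n : ℕ∞)

/-- The associated group `⟨ e_x (x ∈ X) | e_x e_y = e_y e_{x * y} ⟩`. -/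
abbrev As : Type u :=
  PresentedGroup (Set.range fun p : X × X =>
    (FreeGroup.of p.1 * FreeGroup.of p.2) *
      (FreeGroup.of p.2 * FreeGroup.of (star p.1 p.2))⁻¹)

/-- The homomorphism `ψ : As X → Inn X` sending `e_x` to `• * x`. -/
def psi : As X →* Inn X :=
  PresentedGroup.toGroup
    (f := fun x => ⟨rightTranslation x, Subgroup.subset_closure ⟨x, rfl⟩⟩)
    (by
      rintro _ ⟨⟨x, y⟩, rfl⟩
      simp only [map_mul, map_inv, FreeGroup.lift_apply_of]
      rw [mul_inv_eq_one]
      apply Subtype.ext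
      apply MulOpposite.unop_injective
      ext z
      exact Shelf.self_distrib)

/-- `∂_2(x, y) = (x) - (x * y)`. -/
def rackD2 : (X × X →₀ ℤ) →ₗ[ℤ] (X →₀ ℤ) :=
  linearCombination ℤ fun p => single p.1 1 - single (star p.1 p.2) 1

/-- `∂_3(x, y, z) = (x, z) - (x * y, z) - (x, y) + (x * z, y * z)`. -/
def rackD3 : (X × X × X →₀ ℤ) →ₗ[ℤ] (X × X →₀ ℤ) :=
  linearCombination ℤ fun p =>
    single (p.1, p.2.2) 1 - single (star p.1 p.2.1, p.2.2) 1
      - single (p.1, p.2.1) 1 + single (star p.1 p.2.2, star p.2.1 p.2.2) 1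

/-- The submodule of `ℤ⟨X²⟩` spanned by `Im ∂_3` and the pairs `(a, a)`. -/
def quandleB2 : Submodule ℤ (X × X →₀ ℤ) :=
  LinearMap.range (rackD3 X) ⊔ Submodule.span ℤ (Set.range fun a : X => single (a, a) 1)

/-- The second quandle homology `H_2^Q(X; ℤ)`. -/
abbrev H2Q : Type u :=
  LinearMap.ker (rackD2 X) ⧸ (quandleB2 X).comap (LinearMap.ker (rackD2 X)).subtype

/-- The inclusion of `H_2^Q(X; ℤ)` into the group of all 2-chains modulo `quandleB2 X`. -/
def H2Q.toChains : H2Q X →ₗ[ℤ] (X × X →₀ ℤ) ⧸ quandleB2 X :=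
  Submodule.mapQ _ _ (LinearMap.ker (rackD2 X)).subtype le_rfl

variable {X} in
/-- The permutation `(x, q) ↦ (x * y, q + [(x, y)])` of `X × (ℤ⟨X²⟩ / quandleB2 X)`. -/
def pathStep (y : X) : Equiv.Perm (X × ((X × X →₀ ℤ) ⧸ quandleB2 X)) where
  toFun p := (star p.1 y, p.2 + (quandleB2 X).mkQ (single (p.1, y) 1))
  invFun p := (Rack.invAct y p.1, p.2 - (quandleB2 X).mkQ (single (Rack.invAct y p.1, y) 1))
  left_inv p := by simp [star]
  right_inv p := by simp [star]

/-- The right action of `As X` on `X × (ℤ⟨X²⟩ / quandleB2 X)` in which `e_y` acts by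
`(x, q) ↦ (x * y, q + [(x, y)])`. -/
def pathAction : As X →* (Equiv.Perm (X × ((X × X →₀ ℤ) ⧸ quandleB2 X)))ᵐᵒᵖ :=
  PresentedGroup.toGroup (f := fun y => MulOpposite.op (pathStep y))
    (by
      rintro _ ⟨⟨y, z⟩, rfl⟩
      simp only [map_mul, map_inv, FreeGroup.lift_apply_of]
      rw [mul_inv_eq_one]
      apply MulOpposite.unop_injective
      refine Equiv.ext ?_
      rintro ⟨x, q⟩
      have h : (quandleB2 X).mkQ (rackD3 X (single (x, y, z) 1)) = 0 :=
        (Submodule.Quotient.mk_eq_zero _).2 (Submodule.mem_sup_left ⟨_, rfl⟩)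
      simp only [rackD3, linearCombination_single, one_smul, map_add, map_sub] at h
      refine Prod.ext ?_ ?_
      · exact Shelf.self_distrib
      · simp only [pathStep, MulOpposite.unop_mul, MulOpposite.unop_op, Equiv.Perm.mul_apply,
          Equiv.coe_fn_mk]
        rw [add_assoc, add_assoc, add_right_inj, ← sub_eq_zero, ← neg_eq_zero, ← h]
        abel)

variable {X} in
/-- For `g = e_{x_1}^{ε_1} ⋯ e_{x_n}^{ε_n}` in `As X`, the class of the 2-chain
`∑_j ε_j ((⋯(x₀ *^{ε_1} x_1)⋯ *^{ε_{j-1}} x_{j-1}) *^{(ε_j - 1)/2} x_j, x_j)`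
modulo `quandleB2 X`. On the stabilizer of `x₀` in `As X` this is a homomorphism to
`H_2^Q(X; ℤ)`. -/
def pathClass (x₀ : X) (g : As X) : (X × X →₀ ℤ) ⧸ quandleB2 X :=
  ((pathAction X g).unop (x₀, 0)).2

variable {X} in
/-- `T` is the homomorphism `𝒯_*` given by the diagram of the two central extensions
`Ker ψ → As X → Inn X` and `Ker ψ → Stab~(x₀) → Stab(x₀)`: on the image of `H_2(Inn X; ℤ)`, which
is all of `Ker (H_2(Inn X, Stab x₀) → H_1(Stab x₀))`, it is the composite
`H_2(Inn X) → Ker ψ → H_1(Stab~(x₀)) → H_2^Q(X; ℤ)`, whose first map is the connecting map of the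
central extension, `[∑ n_i (g_i, h_i)] ↦ ∏ (s(g_i) s(h_i) s(g_i h_i)⁻¹)^{n_i}` for a set-theoretic
section `s` of `ψ`, and whose last map is `g ↦ pathClass x₀ g`. -/
def IsTransgression (x₀ : X)
    (T : LinearMap.ker (connecting (Stab x₀)) →ₗ[ℤ] H2Q X) : Prop :=
  ∀ s : Inn X → As X, (∀ g, psi X (s g) = g) →
    ∀ z : LinearMap.ker (barD2 (Inn X)),
      H2Q.toChains X (T (absToRel (Stab x₀) z)) =
        z.1.sum fun p n => n • pathClass x₀ (s p.1 * s p.2 * (s (p.1 * p.2))⁻¹)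

end Quandle

/-- The complement of the prime ideal `(ℓ)` in `ℤ`; localizing at it is `M ↦ M_(ℓ)`. -/
def primeCompl (ℓ : ℕ) [hℓ : Fact ℓ.Prime] : Submonoid ℤ :=
  haveI : (Ideal.span {(ℓ : ℤ)}).IsPrime :=
    (Ideal.span_singleton_prime (Int.natCast_ne_zero.2 hℓ.out.ne_zero)).2
      (Nat.prime_iff_prime_int.1 hℓ.out)
  (Ideal.span {(ℓ : ℤ)}).primeCompl

end QuandleSchur

end

/-!
Write `A = As X`, `G = Inn X`, `S = Stab x₀`, and let `S̃` be the stabilizer of `x₀` in `A`. The map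
`ψ : A → G` is a central extension, because conjugation in `A` permutes the generators through the
action on `X`.

Path classes restrict to a homomorphism `S̃ → H_2^Q(X; ℤ)`. It is surjective
(`exists_pathClass_eq`), and every homomorphism from `S̃` to an abelian group that vanishes at
`e_{x₀}` factors through it (`exists_factor_pathClass`). Fix a section `s` of `ψ`. Sending `(g, h)`
to the path class of `s(g) s(h) s(gh)⁻¹`, and `k ∈ S` to that of `s(k)`, kills relative boundaries,
so it defines `F : H_2(G, S) → H_2^Q(X)` (`relPathClass`). The restriction of `F` to the kernel of
`H_2(G, S) → H_1(S)` is `𝒯_*`; on absolute cycles of `G` it does not depend on `s`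
(`factorClass_eq_of_mem_ker`).

It remains to invert `F` up to multiplication by `n = Type(X)`, which becomes a unit at `ℓ`.
The main point is that `n` times any central extension of `A` splits (`exists_cochain`). Indeed
`e_{x₀}ⁿ` is central, so commutators with it form a homomorphism on `A`; it vanishes at `e_{x₀}`,
and the abelianization of `A` is generated by `e_{x₀}`, so it is trivial. Hence in `n` times the
extension a lift of `e_{x₀}` commutes with everything over `S̃`, and its conjugates are lifts of the
generators satisfying the relations of `A`. Apply this to the tautological cocycle on `G`, with
values in relative `2`-chains modulo boundaries. The resulting cochain `c : A → RelChains S`,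
corrected on `S̃` by `n` times the tautological `1`-cochain of `S` and by a multiple of the degree,
is a homomorphism on `S̃` vanishing at `e_{x₀}`. It therefore factors through a map
`D : H_2^Q(X) → H_2(G, S)`. Both composites of `F` and `D` are multiplication by `n`
(`exists_inverse`); each time the two sides differ by a homomorphism on `A`, which is determined
by its value at `e_{x₀}`, or by a term depending only on the boundary of the chain.
-/

noncomputable section

namespace QuandleSchur

open Finsupp

universe u

/-! ### The associated group -/

section AssociatedGroup

variable {X : Type u} [Quandle X]

/-- The generator `e_x` of the associated group. -/
def gen (x : X) : As X := PresentedGroup.of x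

/-- The right action of the associated group on the quandle, `x · e_y = x * y`. -/
def act (x : X) (a : As X) : X := (psi X a).1.unop x

@[simp]
lemma act_one (x : X) : act x 1 = x := by simp [act]

lemma act_mul (x : X) (a b : As X) : act x (a * b) = act (act x a) b := by simp [act]

@[simp]
lemma act_gen (x y : X) : act x (gen y) = star x y := by
  simp [act, gen, psi, rightTranslation]

@[simp]
lemma act_act_inv (x : X) (a : As X) : act (act x a) a⁻¹ = x := by simp [← act_mul]

@[simp]
lemma act_inv_act (x : X) (a : As X) : act (act x a⁻¹) a = x := by simp [← act_mul]

lemma act_of_psi_eq_one {a : As X} (ha : psi X a = 1) (x : X) : act x a = x := by simp [act, ha]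

lemma mem_stab_iff {x : X} {g : Inn X} : g ∈ Stab x ↔ g.1.unop x = x := by
  simp [Stab, Subgroup.mem_subgroupOf]

lemma psi_mem_stab_iff {x : X} {a : As X} : psi X a ∈ Stab x ↔ act x a = x := mem_stab_iff

@[elab_as_elim]
lemma As.induction {p : As X → Prop} (hgen : ∀ x, p (gen x)) (hone : p 1)
    (hmul : ∀ a b, p a → p b → p (a * b)) (hinv : ∀ a, p a → p a⁻¹) (a : As X) : p a := by
  have ha : a ∈ Subgroup.closure (Set.range (gen : X → As X)) := by
    have h : Subgroup.closure (Set.range (gen : X → As X)) = ⊤ := PresentedGroup.closure_range_of _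
    rw [h]
    trivial
  induction ha using Subgroup.closure_induction with
  | mem x hx => obtain ⟨y, rfl⟩ := hx; exact hgen y
  | one => exact hone
  | mul a b _ _ h₁ h₂ => exact hmul a b h₁ h₂
  | inv a _ h => exact hinv a h

lemma gen_mul_gen (x y : X) : gen x * gen y = gen y * gen (star x y) := by
  have h := PresentedGroup.one_of_mem (rels := Set.range fun p : X × X =>
    (FreeGroup.of p.1 * FreeGroup.of p.2) *
      (FreeGroup.of p.2 * FreeGroup.of (star p.1 p.2))⁻¹) ⟨(x, y), rfl⟩
  simp only [map_mul, map_inv] at h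
  exact mul_inv_eq_one.1 h

lemma gen_mul (x : X) (a : As X) : gen x * a = a * gen (act x a) := by
  induction a using As.induction generalizing x with
  | hgen y => rw [gen_mul_gen, act_gen]
  | hone => simp
  | hmul a b ha hb => rw [← mul_assoc, ha, mul_assoc, hb, ← mul_assoc, act_mul]
  | hinv a ha =>
    have h := ha (act x a⁻¹)
    rw [act_inv_act] at h
    rw [eq_inv_mul_iff_mul_eq, ← mul_assoc, ← h, mul_assoc, mul_inv_cancel, mul_one]

lemma inv_mul_gen_mul (x : X) (a : As X) : a⁻¹ * gen x * a = gen (act x a) := by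
  rw [mul_assoc, gen_mul, inv_mul_cancel_left]

/-- `As X → Inn X` is a central extension: conjugation permutes the generators through the action
on `X`, so an element acting trivially commutes with every generator. -/
lemma commute_of_psi_eq_one {a : As X} (ha : psi X a = 1) (b : As X) : a * b = b * a := by
  induction b using As.induction with
  | hgen y => rw [gen_mul, act_of_psi_eq_one ha]
  | hone => simp
  | hmul b c hb hc => rw [← mul_assoc, hb, mul_assoc, hc, mul_assoc]
  | hinv b hb => rw [eq_inv_mul_iff_mul_eq, ← mul_assoc, ← hb, mul_assoc, mul_inv_cancel, mul_one]

lemma psi_surjective : Function.Surjective (psi X) := by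
  rw [← MonoidHom.range_eq_top, eq_top_iff]
  rintro ⟨g, hg⟩ -
  induction hg using Subgroup.closure_induction with
  | mem x hx =>
    obtain ⟨y, rfl⟩ := hx
    exact ⟨gen y, by simp [psi, gen]⟩
  | one => exact one_mem _
  | mul a b ha hb h₁ h₂ => exact mul_mem h₁ h₂
  | inv a ha h => exact inv_mem h

/-- The degree homomorphism `As X → ℤ`, `e_x ↦ 1`. -/
def degHom : As X →* Multiplicative ℤ :=
  PresentedGroup.toGroup (f := fun _ => Multiplicative.ofAdd 1) (by
    rintro _ ⟨⟨x, y⟩, rfl⟩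
    simp)

/-- The degree of an element of `As X`, as an integer. -/
def deg (a : As X) : ℤ := (degHom a).toAdd

lemma deg_mul (a b : As X) : deg (a * b) = deg a + deg b := by simp [deg]

@[simp]
lemma deg_inv (a : As X) : deg a⁻¹ = -deg a := by simp [deg]

@[simp]
lemma deg_gen (x : X) : deg (gen x) = 1 := by simp [deg, degHom, gen]

lemma exists_act_eq (hX : IsConnected X) (x y : X) : ∃ a : As X, act x a = y := by
  obtain ⟨g, hg, h⟩ := hX x y
  obtain ⟨a, ha⟩ := psi_surjective ⟨g, hg⟩
  exact ⟨a, by rw [act, ha]; exact h⟩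

/-- For connected `X` all generators of `As X` are conjugate, so the abelianization of `As X` is
infinite cyclic, the isomorphism with `ℤ` being the degree. -/
lemma eq_deg_smul (hX : IsConnected X) (x₀ : X) {M : Type*} [AddCommGroup M] (F : As X → M)
    (hF : ∀ a b, F (a * b) = F a + F b) (a : As X) : F a = deg a • F (gen x₀) := by
  have h1 : F 1 = 0 := by simpa using hF 1 1
  have hinv (a : As X) : F a⁻¹ = -F a := by
    rw [eq_neg_iff_add_eq_zero, ← hF, inv_mul_cancel, h1]
  induction a using As.induction with
  | hgen y =>
    obtain ⟨b, rfl⟩ := exists_act_eq hX x₀ y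
    rw [← inv_mul_gen_mul, hF, hF, hinv, deg_mul, deg_mul]
    simp
  | hone => simp [h1, deg]
  | hmul a b ha hb => rw [hF, ha, hb, deg_mul, add_smul]
  | hinv a ha => rw [hinv, ha, deg_inv, neg_smul]

/-- If all right translations have period `n`, then the `n`-th power of a generator acts trivially,
so it is central. -/
lemma psi_gen_pow_eq_one {n : ℕ} (hn : ∀ x y : X, (fun z => star z y)^[n] x = x) (y : X) :
    psi X (gen y ^ n) = 1 := by
  have key (m : ℕ) (x : X) : act x (gen y ^ m) = (fun z => star z y)^[m] x := by
    induction m with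
    | zero => simp
    | succ m ih => rw [pow_succ, act_mul, ih, act_gen, Function.iterate_succ_apply']
  apply Subtype.ext
  apply MulOpposite.unop_injective
  ext x
  exact (key n x).trans (hn x y)

/-! ### The class of a path -/

lemma pathAction_gen (y : X) : (pathAction X (gen y)).unop = pathStep y := by
  simp [pathAction, gen]

lemma pathAction_apply (a : As X) (x : X) (q : (X × X →₀ ℤ) ⧸ quandleB2 X) :
    (pathAction X a).unop (x, q) = (act x a, q + pathClass x a) := by
  have h : ∃ f : X → (X × X →₀ ℤ) ⧸ quandleB2 X,
      ∀ x q, (pathAction X a).unop (x, q) = (act x a, q + f x) := by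
    clear x q
    induction a using As.induction with
    | hgen y =>
      refine ⟨fun x => (quandleB2 X).mkQ (single (x, y) 1), fun x q => ?_⟩
      rw [pathAction_gen, act_gen]
      rfl
    | hone => exact ⟨0, fun x q => by simp⟩
    | hmul a b ha hb =>
      obtain ⟨f, hf⟩ := ha
      obtain ⟨g, hg⟩ := hb
      refine ⟨fun x => f x + g (act x a), fun x q => ?_⟩
      rw [map_mul, MulOpposite.unop_mul, Equiv.Perm.mul_apply, hf, hg, act_mul, add_assoc]
    | hinv a ha =>
      obtain ⟨f, hf⟩ := ha
      refine ⟨fun x => -f (act x a⁻¹), fun x q => ?_⟩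
      rw [map_inv, MulOpposite.unop_inv, Equiv.Perm.inv_eq_iff_eq, hf]
      simp
  obtain ⟨f, hf⟩ := h
  rw [hf, pathClass, hf, zero_add]

lemma pathClass_mul (x : X) (a b : As X) :
    pathClass x (a * b) = pathClass x a + pathClass (act x a) b := by
  have h := pathAction_apply (a * b) x 0
  rw [map_mul, MulOpposite.unop_mul, Equiv.Perm.mul_apply, pathAction_apply a,
    pathAction_apply b] at h
  simpa using (congrArg Prod.snd h).symm

@[simp]
lemma pathClass_gen (x y : X) :
    pathClass x (gen y) = (quandleB2 X).mkQ (single (x, y) 1) := by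
  simp [pathClass, pathAction_gen, pathStep]

@[simp]
lemma pathClass_one (x : X) : pathClass x (1 : As X) = 0 := by
  simpa using pathClass_mul x 1 1

lemma pathClass_inv (x : X) (a : As X) : pathClass x a⁻¹ = -pathClass (act x a⁻¹) a := by
  have h := pathClass_mul x a⁻¹ a
  rw [inv_mul_cancel, pathClass_one] at h
  exact eq_neg_of_add_eq_zero_left h.symm

lemma pathClass_gen_self (x : X) : pathClass x (gen x) = 0 := by
  rw [pathClass_gen]
  exact (Submodule.Quotient.mk_eq_zero _).2
    (Submodule.mem_sup_right (Submodule.subset_span ⟨x, rfl⟩))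

/-- On the stabilizer of `x₀`, the class of a path is a homomorphism. -/
lemma pathClass_mul_of_act_eq {x₀ : X} {a : As X} (ha : act x₀ a = x₀) (b : As X) :
    pathClass x₀ (a * b) = pathClass x₀ a + pathClass x₀ b := by
  rw [pathClass_mul, ha]

lemma pathClass_inv_of_act_eq {x₀ : X} {a : As X} (ha : act x₀ a = x₀) :
    pathClass x₀ a⁻¹ = -pathClass x₀ a := by
  have h : act x₀ a⁻¹ = x₀ := by simpa [ha] using act_act_inv x₀ a
  rw [pathClass_inv, h]

lemma rackD2_comp_rackD3 : rackD2 X ∘ₗ rackD3 X = 0 := by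
  ext ⟨x, y, z⟩ : 2
  have h : star (star x y) z = star (star x z) (star y z) := Shelf.self_distrib
  simp only [rackD2, rackD3, LinearMap.comp_apply, lsingle_apply, linearCombination_single,
    one_smul, map_add, map_sub, LinearMap.zero_apply, h]
  abel

/-- The boundary of a `2`-chain modulo `quandleB2 X`. -/
def chainBoundary : ((X × X →₀ ℤ) ⧸ quandleB2 X) →ₗ[ℤ] (X →₀ ℤ) :=
  (quandleB2 X).liftQ (rackD2 X) (by
    rw [quandleB2, sup_le_iff, LinearMap.range_le_ker_iff, Submodule.span_le]
    refine ⟨rackD2_comp_rackD3, ?_⟩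
    rintro _ ⟨a, rfl⟩
    simp [rackD2, star])

lemma chainBoundary_pathClass (x : X) (a : As X) :
    chainBoundary (pathClass x a) = single x 1 - single (act x a) 1 := by
  induction a using As.induction generalizing x with
  | hgen y => simp [chainBoundary, rackD2]
  | hone => simp
  | hmul a b ha hb => rw [pathClass_mul, map_add, ha, hb, act_mul, sub_add_sub_cancel]
  | hinv a ha => rw [pathClass_inv, map_neg, ha, act_inv_act, neg_sub]

lemma toChains_injective : Function.Injective (H2Q.toChains X) := by
  rw [← LinearMap.ker_eq_bot, H2Q.toChains, Submodule.mapQ, Submodule.ker_liftQ_eq_bot]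
  rw [LinearMap.ker_comp, Submodule.ker_mkQ]

lemma mem_range_toChains {q : (X × X →₀ ℤ) ⧸ quandleB2 X} :
    q ∈ LinearMap.range (H2Q.toChains X) ↔ chainBoundary q = 0 := by
  obtain ⟨c, rfl⟩ := Submodule.mkQ_surjective _ q
  constructor
  · rintro ⟨h, hh⟩
    obtain ⟨⟨z, hz⟩, rfl⟩ := Submodule.mkQ_surjective _ h
    rw [← hh]
    exact hz
  · intro h
    exact ⟨Submodule.Quotient.mk ⟨c, h⟩, rfl⟩

end AssociatedGroup

/-! ### Relative chains modulo boundaries -/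

section RelativeChains

variable {G : Type u} [Group G] (K : Subgroup G)

lemma barD2_comp_barD3 : barD2 G ∘ₗ barD3 G = 0 := by
  ext ⟨g, h, k⟩ : 2
  simp only [barD2, barD3, LinearMap.comp_apply, lsingle_apply, linearCombination_single,
    one_smul, map_add, map_sub, LinearMap.zero_apply, mul_assoc]
  abel

lemma incl1_single (k : K) (n : ℤ) : incl1 K (single k n) = single (k : G) n := by simp [incl1]

lemma barD2_comp_incl2 : barD2 G ∘ₗ incl2 K = incl1 K ∘ₗ barD2 K := by
  ext ⟨g, h⟩ : 2
  simp [barD2, incl1_single, incl2]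

lemma relD2_comp_relD3 : relD2 K ∘ₗ relD3 K = 0 := by
  refine LinearMap.prod_ext ?_ ?_
  · refine LinearMap.ext fun g => ?_
    simpa [relD2, relD3] using LinearMap.congr_fun (barD2_comp_barD3 (G := G)) _
  · refine LinearMap.ext fun c => ?_
    have h := LinearMap.congr_fun (barD2_comp_incl2 K) c
    simp only [LinearMap.comp_apply] at h
    simp [relD2, relD3, h]

/-- The relative `2`-chains of the pair modulo relative boundaries. -/
abbrev RelChains : Type u := ((G × G →₀ ℤ) × (K →₀ ℤ)) ⧸ LinearMap.range (relD3 K)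

/-- The inclusion of `H_2(G, K; ℤ)` into relative `2`-chains modulo boundaries. -/
def H2Rel.toChains : H2Rel K →ₗ[ℤ] RelChains K :=
  Submodule.mapQ _ _ (LinearMap.ker (relD2 K)).subtype le_rfl

/-- The differential out of the relative `2`-chains modulo boundaries. -/
def relBoundary : RelChains K →ₗ[ℤ] (G →₀ ℤ) :=
  (LinearMap.range (relD3 K)).liftQ (relD2 K)
    (LinearMap.range_le_ker_iff.2 (relD2_comp_relD3 K))

lemma H2Rel.toChains_injective : Function.Injective (H2Rel.toChains K) := by
  rw [← LinearMap.ker_eq_bot, H2Rel.toChains, Submodule.mapQ, Submodule.ker_liftQ_eq_bot]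
  rw [LinearMap.ker_comp, Submodule.ker_mkQ]

lemma H2Rel.mem_range_toChains {q : RelChains K} :
    q ∈ LinearMap.range (H2Rel.toChains K) ↔ relBoundary K q = 0 := by
  obtain ⟨c, rfl⟩ := Submodule.mkQ_surjective _ q
  constructor
  · rintro ⟨h, hh⟩
    obtain ⟨⟨z, hz⟩, rfl⟩ := Submodule.mkQ_surjective _ h
    rw [← hh]
    exact hz
  · intro h
    exact ⟨Submodule.Quotient.mk ⟨c, h⟩, rfl⟩

variable {K}

/-- The class in `RelChains K` of a pair of elements of `G`. -/
def pairClass (K : Subgroup G) (g h : G) : RelChains K :=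
  (LinearMap.range (relD3 K)).mkQ (single (g, h) 1, 0)

/-- The class in `RelChains K` of an element of `K`. -/
def pointClass (k : K) : RelChains K := (LinearMap.range (relD3 K)).mkQ (0, single k 1)

lemma relChains_hom_ext {M : Type*} [AddCommGroup M] {f f' : RelChains K →ₗ[ℤ] M}
    (h₁ : ∀ g h, f (pairClass K g h) = f' (pairClass K g h))
    (h₂ : ∀ k, f (pointClass k) = f' (pointClass k)) : f = f' := by
  refine Submodule.linearMap_qext _ (LinearMap.prod_ext ?_ ?_)
  · ext1 ⟨g, h⟩
    ext1
    exact h₁ g h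
  · ext1 k
    ext1
    exact h₂ k

lemma pairClass_cocycle (g h k : G) :
    pairClass K h k - pairClass K (g * h) k + pairClass K g (h * k) - pairClass K g h = 0 := by
  have H : (LinearMap.range (relD3 K)).mkQ (relD3 K (single (g, h, k) 1, 0)) = 0 :=
    (Submodule.Quotient.mk_eq_zero _).2 ⟨_, rfl⟩
  rw [← H]
  simp only [pairClass, ← map_sub, ← map_add]
  congr 1
  simp [relD3, barD3]

/-- On `K` the tautological cocycle `pairClass` is the coboundary of `pointClass`. -/
lemma pairClass_coe (k l : K) :
    pairClass K k l = pointClass l - pointClass (k * l) + pointClass k := by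
  have H : (LinearMap.range (relD3 K)).mkQ (relD3 K (0, single (k, l) 1)) = 0 :=
    (Submodule.Quotient.mk_eq_zero _).2 ⟨_, rfl⟩
  rw [← sub_eq_zero, ← H]
  simp only [pairClass, pointClass, ← map_sub, ← map_add]
  congr 1
  simp [relD3, barD2, incl2]

lemma pairClass_one_left (g : G) : pairClass K 1 g = pointClass (1 : K) := by
  have h₁ := pairClass_cocycle (K := K) 1 1 g
  have h₂ := pairClass_coe (1 : K) 1
  simp only [one_mul, sub_self, zero_add, OneMemClass.coe_one] at h₁ h₂
  rw [sub_eq_zero.1 h₁, h₂]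

@[simp]
lemma relBoundary_pairClass (g h : G) :
    relBoundary K (pairClass K g h) = single h 1 - single (g * h) 1 + single g 1 := by
  simp [relBoundary, pairClass, relD2, barD2]

@[simp]
lemma relBoundary_pointClass (k : K) :
    relBoundary K (pointClass k) = single (k : G) 1 := by
  simp [relBoundary, pointClass, relD2, incl1]

end RelativeChains

/-! ### The transgression -/

section Transgression

variable {X : Type u} [Quandle X]

/-- The factor set `s(g) s(h) s(gh)⁻¹` of the central extension `As X → Inn X`. -/
def factorSet (s : Inn X → As X) (g h : Inn X) : As X := s g * s h * (s (g * h))⁻¹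

variable {s : Inn X → As X}

lemma psi_factorSet (hs : ∀ g, psi X (s g) = g) (g h : Inn X) :
    psi X (factorSet s g h) = 1 := by
  simp [factorSet, hs]

lemma factorSet_mul_factorSet (hs : ∀ g, psi X (s g) = g) (g h k : Inn X) :
    factorSet s g h * factorSet s (g * h) k = factorSet s h k * factorSet s g (h * k) := by
  have H : factorSet s h k * factorSet s g (h * k) =
      s g * factorSet s h k * (s (h * k) * (s (g * (h * k)))⁻¹) := by
    rw [← commute_of_psi_eq_one (psi_factorSet hs h k) (s g), factorSet.eq_1 s g (h * k)]
    simp only [mul_assoc]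
  rw [H]
  simp [factorSet, mul_assoc]

lemma act_section (hs : ∀ g, psi X (s g) = g) {x₀ : X} (k : Stab x₀) : act x₀ (s k) = x₀ := by
  rw [← psi_mem_stab_iff, hs]
  exact k.2

lemma act_factorSet (hs : ∀ g, psi X (s g) = g) (x : X) (g h : Inn X) :
    act x (factorSet s g h) = x :=
  act_of_psi_eq_one (psi_factorSet hs g h) x

variable (s) in
/-- The linear map on pairs of elements of `Inn X` given by the path classes of the factor set. -/
def factorClass (x₀ : X) : (Inn X × Inn X →₀ ℤ) →ₗ[ℤ] (X × X →₀ ℤ) ⧸ quandleB2 X :=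
  linearCombination ℤ fun p => pathClass x₀ (factorSet s p.1 p.2)

lemma factorClass_comp_barD3 (hs : ∀ g, psi X (s g) = g) (x₀ : X) :
    factorClass s x₀ ∘ₗ barD3 (Inn X) = 0 := by
  ext1 ⟨g, h, k⟩
  ext1
  have H := congrArg (pathClass x₀) (factorSet_mul_factorSet hs g h k)
  rw [pathClass_mul_of_act_eq (act_factorSet hs _ _ _),
    pathClass_mul_of_act_eq (act_factorSet hs _ _ _)] at H
  simp only [LinearMap.comp_apply, lsingle_apply, factorClass, barD3, linearCombination_single,
    one_smul, map_sub, map_add, LinearMap.zero_apply]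
  rw [sub_add_eq_add_sub, ← H]
  abel

lemma factorClass_comp_incl2 (hs : ∀ g, psi X (s g) = g) (x₀ : X) :
    factorClass s x₀ ∘ₗ incl2 (Stab x₀) =
      (linearCombination ℤ fun k : Stab x₀ => pathClass x₀ (s k)) ∘ₗ barD2 (Stab x₀) := by
  ext1 ⟨k, l⟩
  ext1
  have h := act_section hs (k * l)
  simp only [LinearMap.comp_apply, lsingle_apply, factorClass, incl2, barD2,
    linearCombination_single, one_smul, map_sub, map_add, lmapDomain_apply, mapDomain_single,
    factorSet]
  have hkl : act x₀ (s k * s l) = x₀ := by rw [act_mul, act_section hs, act_section hs]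
  rw [pathClass_mul_of_act_eq hkl, pathClass_mul_of_act_eq (act_section hs k), ← Subgroup.coe_mul,
    pathClass_inv_of_act_eq h]
  abel

/-- The map `H_2(Inn X, Stab x₀) → ℤ⟨X²⟩ / quandleB2 X` attached to a section `s`, on relative
chains: the path class of the factor set on `C_2(Inn X)`, and that of `s` on `C_1(Stab x₀)`. Its
restriction to `Ker (H_2(Inn X, Stab x₀) → H_1(Stab x₀))` is independent of `s`. -/
def relPathClass (hs : ∀ g, psi X (s g) = g) (x₀ : X) :
    RelChains (Stab x₀) →ₗ[ℤ] (X × X →₀ ℤ) ⧸ quandleB2 X :=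
  (LinearMap.range (relD3 (Stab x₀))).liftQ
    ((factorClass s x₀).coprod (linearCombination ℤ fun k : Stab x₀ => pathClass x₀ (s k))) (by
      rw [LinearMap.range_le_ker_iff]
      refine LinearMap.ext fun ⟨b, c⟩ => ?_
      have h₁ := LinearMap.congr_fun (factorClass_comp_barD3 hs x₀) b
      have h₂ := LinearMap.congr_fun (factorClass_comp_incl2 hs x₀) c
      simp only [LinearMap.comp_apply, LinearMap.zero_apply] at h₁ h₂
      simp [relD3, h₁, h₂])

@[simp]
lemma relPathClass_pairClass (hs : ∀ g, psi X (s g) = g) (x₀ : X) (g h : Inn X) :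
    relPathClass hs x₀ (pairClass _ g h) = pathClass x₀ (factorSet s g h) := by
  simp [relPathClass, pairClass, factorClass]

@[simp]
lemma relPathClass_pointClass (hs : ∀ g, psi X (s g) = g) (x₀ : X) (k : Stab x₀) :
    relPathClass hs x₀ (pointClass k) = pathClass x₀ (s k) := by
  simp [relPathClass, pointClass]

lemma chainBoundary_relPathClass (hs : ∀ g, psi X (s g) = g) (x₀ : X)
    (q : RelChains (Stab x₀)) : chainBoundary (relPathClass hs x₀ q) = 0 := by
  have h : chainBoundary ∘ₗ relPathClass hs x₀ = 0 := by
    refine relChains_hom_ext (fun g h => ?_) fun k => ?_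
    · simp [chainBoundary_pathClass, act_factorSet hs]
    · simp [chainBoundary_pathClass, act_section hs]
  exact LinearMap.congr_fun h q

/-- Two sections differ by a function with values in the centre, so their factor sets differ by a
coboundary. -/
lemma factorClass_eq_of_mem_ker {s' : Inn X → As X} (hs : ∀ g, psi X (s g) = g)
    (hs' : ∀ g, psi X (s' g) = g) (x₀ : X) {z : Inn X × Inn X →₀ ℤ} (hz : barD2 (Inn X) z = 0) :
    factorClass s' x₀ z = factorClass s x₀ z := by
  let t (g : Inn X) : As X := s' g * (s g)⁻¹
  have ht (g : Inn X) : psi X (t g) = 1 := by simp [t, hs, hs']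
  have ha (g : Inn X) : act x₀ (t g) = x₀ := act_of_psi_eq_one (ht g) x₀
  have key : factorClass s' x₀ =
      factorClass s x₀ + (linearCombination ℤ fun g => pathClass x₀ (t g)) ∘ₗ barD2 (Inn X) := by
    ext1 ⟨g, h⟩
    ext1
    have H : factorSet s' g h * t (g * h) = t g * (t h * factorSet s g h) := by
      rw [commute_of_psi_eq_one (ht h)]
      have h' : factorSet s g h * t h * s (g * h) = s g * s' h := by
        rw [← commute_of_psi_eq_one (ht h), mul_assoc, factorSet, inv_mul_cancel_right,
          ← mul_assoc, commute_of_psi_eq_one (ht h)]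
        simp [t, mul_assoc]
      rw [← mul_left_inj (s (g * h)), mul_assoc (t g), h']
      simp [t, factorSet, mul_assoc]
    have H' := congrArg (pathClass x₀) H
    rw [pathClass_mul_of_act_eq (act_factorSet hs' _ _ _), pathClass_mul_of_act_eq (ha g),
      pathClass_mul_of_act_eq (ha h)] at H'
    simp only [LinearMap.comp_apply, LinearMap.add_apply, lsingle_apply, factorClass, barD2,
      linearCombination_single, one_smul, map_sub, map_add]
    rw [eq_sub_of_add_eq H']
    abel
  rw [key, LinearMap.add_apply, LinearMap.comp_apply, hz, map_zero, add_zero]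

end Transgression

/-! ### Central extensions of the associated group -/

section CentralExtensions

/-- A `2`-cocycle on `A` with values in the trivial module `M`. -/
structure TwoCocycle (A M : Type*) [Group A] [AddCommGroup M] where
  /-- The underlying function. -/
  toFun : A → A → M
  cocycle : ∀ a b c,
    toFun b c - toFun (a * b) c + toFun a (b * c) - toFun a b = 0

variable {A M : Type*} [Group A] [AddCommGroup M]

/-- The central extension of `A` by `M` with factor set `u`. The cocycle is not assumed to be
normalized. -/
@[ext]
structure CocycleExt (u : TwoCocycle A M) where
  /-- The component in the central subgroup. -/
  fst : M
  /-- The projection to the quotient. -/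
  snd : A

namespace TwoCocycle

variable (u : TwoCocycle A M)

lemma apply_mul (a b c : A) : u.toFun (a * b) c + u.toFun a b = u.toFun b c + u.toFun a (b * c) := by
  rw [← sub_eq_zero, ← neg_eq_zero, ← u.cocycle a b c]
  abel

lemma one_left (a : A) : u.toFun 1 a = u.toFun 1 1 := by
  have h := u.apply_mul 1 1 a
  simpa using h.symm

/-- The pairing `u(a, b) - u(b, a)` is additive in each variable on commuting elements: it is the
commutator of lifts of `a` and `b` to the central extension. -/
lemma pairing_mul_right {a b c : A} (hb : a * b = b * a) (hc : a * c = c * a) :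
    u.toFun a (b * c) - u.toFun (b * c) a =
      (u.toFun a b - u.toFun b a) + (u.toFun a c - u.toFun c a) := by
  have h₁ := u.cocycle a b c
  have h₂ := u.cocycle b c a
  have h₃ := u.cocycle b a c
  rw [hb] at h₁
  rw [hc] at h₃
  rw [← sub_eq_zero]
  calc _ = (u.toFun b c - u.toFun (b * a) c + u.toFun a (b * c) - u.toFun a b)
        + (u.toFun c a - u.toFun (b * c) a + u.toFun b (c * a) - u.toFun b c)
        - (u.toFun a c - u.toFun (b * a) c + u.toFun b (c * a) - u.toFun b a) := by abel
    _ = 0 := by rw [h₁, h₂, h₃]; simp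

lemma pairing_pow_left {a b : A} (h : a * b = b * a) (n : ℕ) :
    u.toFun (a ^ n) b - u.toFun b (a ^ n) = n • (u.toFun a b - u.toFun b a) := by
  induction n with
  | zero =>
    have h₁ := u.pairing_mul_right (a := b) (b := 1) (c := 1) (by simp) (by simp)
    rw [mul_one, left_eq_add] at h₁
    rw [pow_zero, zero_smul, ← neg_sub, h₁, neg_zero]
  | succ n ih =>
    have h₁ := u.pairing_mul_right (a := b) (b := a ^ n) (c := a)
      ((Commute.pow_left h n).symm) h.symm
    rw [pow_succ, ← neg_sub, h₁, succ_nsmul, ← ih]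
    abel

/-- A multiple of a `2`-cocycle. -/
def nsmul (n : ℕ) : TwoCocycle A M where
  toFun a b := n • u.toFun a b
  cocycle a b c := by rw [← smul_sub, ← smul_add, ← smul_sub, u.cocycle, smul_zero]

@[simp]
lemma nsmul_toFun (n : ℕ) (a b : A) : (u.nsmul n).toFun a b = n • u.toFun a b := rfl

end TwoCocycle

namespace CocycleExt

variable {u : TwoCocycle A M}

instance : Mul (CocycleExt u) := ⟨fun x y => ⟨x.fst + y.fst + u.toFun x.snd y.snd, x.snd * y.snd⟩⟩

instance : One (CocycleExt u) := ⟨⟨-u.toFun 1 1, 1⟩⟩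

instance : Inv (CocycleExt u) :=
  ⟨fun x => ⟨-x.fst - u.toFun x.snd⁻¹ x.snd - u.toFun 1 1, x.snd⁻¹⟩⟩

@[simp]
lemma mul_fst (x y : CocycleExt u) : (x * y).fst = x.fst + y.fst + u.toFun x.snd y.snd := rfl

@[simp]
lemma mul_snd (x y : CocycleExt u) : (x * y).snd = x.snd * y.snd := rfl

lemma one_fst : (1 : CocycleExt u).fst = -u.toFun 1 1 := rfl

lemma one_snd : (1 : CocycleExt u).snd = 1 := rfl

lemma inv_fst (x : CocycleExt u) :
    x⁻¹.fst = -x.fst - u.toFun x.snd⁻¹ x.snd - u.toFun 1 1 := rfl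

lemma inv_snd (x : CocycleExt u) : x⁻¹.snd = x.snd⁻¹ := rfl

instance : Group (CocycleExt u) :=
  Group.ofLeftAxioms
    (fun x y z => by
      apply CocycleExt.ext
      · have h := u.apply_mul x.snd y.snd z.snd
        simp only [mul_fst, mul_snd]
        rw [← sub_eq_zero] at h ⊢
        rw [← h]
        abel
      · simp [mul_assoc])
    (fun x => by
      apply CocycleExt.ext
      · simp [one_fst, one_snd, u.one_left]
      · simp [one_snd])
    (fun x => by
      apply CocycleExt.ext
      · simp only [mul_fst, inv_fst, inv_snd, one_fst]
        abel
      · simp [inv_snd, one_snd])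

/-- The projection of the extension onto `A`. -/
def proj : CocycleExt u →* A where
  toFun := snd
  map_one' := rfl
  map_mul' _ _ := rfl

end CocycleExt

variable {X : Type u} [Quandle X]

lemma gen_mul_comm_of_act_eq {x₀ : X} {a : As X} (ha : act x₀ a = x₀) :
    gen x₀ * a = a * gen x₀ := by
  rw [gen_mul, ha]

/-- The commutator pairing of `e_{x₀}` with its centralizer is killed by a common period `n` of
the right translations: `n` times it is the pairing with the central element `e_{x₀}ⁿ`, which is a
homomorphism on `As X` vanishing at `e_{x₀}`, hence everywhere. -/
lemma nsmul_pairing_eq_zero (hX : IsConnected X) {n : ℕ}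
    (hn : ∀ x y : X, (fun z => star z y)^[n] x = x) (u : TwoCocycle (As X) M)
    {x₀ : X} {a : As X} (ha : act x₀ a = x₀) :
    n • (u.toFun (gen x₀) a - u.toFun a (gen x₀)) = 0 := by
  have hc (b : As X) : gen x₀ ^ n * b = b * gen x₀ ^ n :=
    commute_of_psi_eq_one (psi_gen_pow_eq_one hn x₀) b
  rw [← u.pairing_pow_left (gen_mul_comm_of_act_eq ha),
    eq_deg_smul hX x₀ (fun b => u.toFun (gen x₀ ^ n) b - u.toFun b (gen x₀ ^ n))
      (fun b c => u.pairing_mul_right (hc b) (hc c)) a,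
    u.pairing_pow_left rfl, sub_self, smul_zero, smul_zero]

/-- A common period `n` of the right translations annihilates every central extension of `As X`,
that is, `n H_2(As X; ℤ) = 0`. In the extension by `n u` the lift of `e_{x₀}` commutes with
everything over the stabilizer of `x₀`, so the conjugates of this lift form a system of lifts of
the generators which is well defined and satisfies the defining relations. -/
theorem exists_cochain (hX : IsConnected X) (x₀ : X) {n : ℕ}
    (hn : ∀ x y : X, (fun z => star z y)^[n] x = x) (u : TwoCocycle (As X) M) :
    ∃ c : As X → M, ∀ a b, c (a * b) = c a + c b + n • u.toFun a b := by
  choose p hp using exists_act_eq hX x₀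
  let e₀ : CocycleExt (u.nsmul n) := ⟨0, gen x₀⟩
  let P (x : X) : CocycleExt (u.nsmul n) := ⟨0, p x⟩
  let e (x : X) : CocycleExt (u.nsmul n) := (P x)⁻¹ * e₀ * P x
  have hcomm (w : CocycleExt (u.nsmul n)) (hw : act x₀ w.snd = x₀) : e₀ * w = w * e₀ := by
    apply CocycleExt.ext
    · have h := nsmul_pairing_eq_zero hX hn u hw
      rw [smul_sub, sub_eq_zero] at h
      simp only [CocycleExt.mul_fst, TwoCocycle.nsmul_toFun, e₀, h, zero_add, add_zero]
    · exact gen_mul_comm_of_act_eq hw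
  have hconj (w : CocycleExt (u.nsmul n)) (x : X) (hw : act x₀ w.snd = x) :
      w⁻¹ * e₀ * w = e x := by
    have h := hcomm (w * (P x)⁻¹) (by
      rw [CocycleExt.mul_snd, act_mul, hw, CocycleExt.inv_snd]
      simpa [hp] using act_act_inv x₀ (p x))
    calc w⁻¹ * e₀ * w = w⁻¹ * (e₀ * (w * (P x)⁻¹)) * P x := by simp [mul_assoc]
      _ = e x := by rw [h]; simp [e, mul_assoc]
  have hsnd (x : X) : (e x).snd = gen x := by
    have h := inv_mul_gen_mul x₀ (p x)
    rwa [hp] at h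
  let σ : As X →* CocycleExt (u.nsmul n) := PresentedGroup.toGroup (f := e) (by
    rintro _ ⟨⟨x, y⟩, rfl⟩
    simp only [map_mul, map_inv, FreeGroup.lift_apply_of]
    rw [mul_inv_eq_one, ← hconj (P x * e y) (star x y)]
    · simp only [e, mul_assoc, mul_inv_rev, mul_inv_cancel_left]
    · rw [CocycleExt.mul_snd, act_mul, hp, hsnd, act_gen])
  have hσ : CocycleExt.proj.comp σ = MonoidHom.id _ := by
    refine PresentedGroup.ext fun x => ?_
    have h : σ (PresentedGroup.of x) = e x := PresentedGroup.toGroup.of _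
    rw [MonoidHom.comp_apply, h]
    exact hsnd x
  refine ⟨fun a => (σ a).fst, fun a b => ?_⟩
  have h (a : As X) : (σ a).snd = a := DFunLike.congr_fun hσ a
  simp only [map_mul, CocycleExt.mul_fst, h, TwoCocycle.nsmul_toFun]

end CentralExtensions

/-! ### The stabilizer in the associated group and quandle homology -/

section Stabilizer

variable {X : Type u} [Quandle X]

/-- The stabilizer of `x₀` in `As X`. -/
def stabAs (x₀ : X) : Subgroup (As X) := (Stab x₀).comap (psi X)

lemma mem_stabAs {x₀ : X} {a : As X} : a ∈ stabAs x₀ ↔ act x₀ a = x₀ := psi_mem_stab_iff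

/-- The restriction of `ψ` to stabilizers. -/
def psiStab {x₀ : X} (h : stabAs x₀) : Stab x₀ := ⟨psi X h, h.2⟩

/-- The generator `e_{x₀}` as an element of the stabilizer of `x₀`. -/
def genStab (x₀ : X) : stabAs x₀ := ⟨gen x₀, mem_stabAs.2 (by simp [star])⟩

/-- For a choice of `p x ∈ As X` moving `x₀` to `x`, the loop at `x₀` that goes along `p x`,
follows `a` and returns. -/
def loop {x₀ : X} (p : X → As X) (hp : ∀ x, act x₀ (p x) = x) (x : X) (a : As X) : stabAs x₀ :=
  ⟨p x * a * (p (act x a))⁻¹, mem_stabAs.2 (by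
    rw [act_mul, act_mul, hp]
    simpa [hp] using act_act_inv x₀ (p (act x a)))⟩

lemma loop_mul {x₀ : X} {p : X → As X} (hp : ∀ x, act x₀ (p x) = x) (x : X) (a b : As X) :
    loop p hp x (a * b) = loop p hp x a * loop p hp (act x a) b := by
  apply Subtype.ext
  simp [loop, act_mul, mul_assoc]

/-- The path class as a homomorphism on the stabilizer of `x₀`. -/
def pathHom (x₀ : X) : Additive (stabAs x₀) →+ (X × X →₀ ℤ) ⧸ quandleB2 X where
  toFun h := pathClass x₀ (h.toMul : As X)
  map_zero' := pathClass_one x₀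
  map_add' h _ := pathClass_mul_of_act_eq (mem_stabAs.1 h.toMul.2) _

/-- Every class in `H_2^Q(X; ℤ)` is the path class of an element of the stabilizer of `x₀`. -/
lemma exists_pathClass_eq (hX : IsConnected X) (x₀ : X) {q : (X × X →₀ ℤ) ⧸ quandleB2 X}
    (hq : chainBoundary q = 0) : ∃ h : stabAs x₀, pathClass x₀ (h : As X) = q := by
  choose p hp using exists_act_eq hX x₀
  let L : (X →₀ ℤ) →ₗ[ℤ] (X × X →₀ ℤ) ⧸ quandleB2 X :=
    linearCombination ℤ fun x => pathClass x₀ (p x)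
  let N := (pathHom x₀).range
  -- Closing up each edge along the chosen paths changes a chain by a function of its boundary.
  have key (c : X × X →₀ ℤ) : (quandleB2 X).mkQ c + L (rackD2 X c) ∈ N := by
    induction c using Finsupp.induction_linear with
    | zero => simp [N.zero_mem]
    | add c d hc hd =>
      rw [map_add, map_add, map_add, add_add_add_comm]
      exact N.add_mem hc hd
    | single e m =>
      obtain ⟨x, y⟩ := e
      rw [← mul_one m, ← smul_eq_mul, ← smul_single, map_smul, map_smul, map_smul, ← smul_add]
      refine N.zsmul_mem ⟨Additive.ofMul (loop p hp x (gen y)), ?_⟩ m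
      change pathClass x₀ (p x * gen y * (p (act x (gen y)))⁻¹) = _
      rw [pathClass_mul, pathClass_mul, act_mul, hp, pathClass_inv, act_gen]
      have h : act (star x y) (p (star x y))⁻¹ = x₀ := by
        simpa [hp] using act_act_inv x₀ (p (star x y))
      rw [h, pathClass_gen]
      simp only [L, rackD2, linearCombination_single, one_smul, map_sub]
      abel
  obtain ⟨c, rfl⟩ := Submodule.mkQ_surjective _ q
  have h := key c
  have hc : rackD2 X c = 0 := hq
  rw [hc, map_zero, add_zero] at h
  obtain ⟨a, ha⟩ := h
  exact ⟨a.toMul, ha⟩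

/-- A homomorphism from the stabilizer of `x₀` to an abelian group which vanishes at `e_{x₀}`
factors through the path class: the kernel of the path class on the stabilizer is generated by
commutators and `e_{x₀}`. -/
lemma exists_factor_pathClass (hX : IsConnected X) (x₀ : X) {M : Type*} [AddCommGroup M]
    (d : Additive (stabAs x₀) →+ M) (hd : d (Additive.ofMul (genStab x₀)) = 0) :
    ∃ D : ((X × X →₀ ℤ) ⧸ quandleB2 X) →ₗ[ℤ] M,
      ∀ h : stabAs x₀, D (pathClass x₀ (h : As X)) = d (Additive.ofMul h) := by
  choose p hp using exists_act_eq hX x₀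
  let f (x : X) (a : As X) : M := d (Additive.ofMul (loop p hp x a))
  have f_mul (x : X) (a b : As X) : f x (a * b) = f x a + f (act x a) b := by
    simp only [f, loop_mul, ofMul_mul, map_add]
  let E : (X × X →₀ ℤ) →ₗ[ℤ] M := linearCombination ℤ fun e => f e.1 (gen e.2)
  have hE : quandleB2 X ≤ LinearMap.ker E := by
    rw [quandleB2, sup_le_iff, LinearMap.range_le_ker_iff, Submodule.span_le]
    constructor
    · ext1 ⟨x, y, z⟩
      ext1
      have h := congrArg (f x) (gen_mul_gen y z)
      rw [f_mul, f_mul, act_gen, act_gen] at h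
      simp only [E, LinearMap.comp_apply, lsingle_apply, rackD3, linearCombination_single,
        one_smul, map_sub, map_add, LinearMap.zero_apply]
      rw [← sub_eq_zero.2 h.symm]
      abel
    · rintro _ ⟨x, rfl⟩
      -- The loop of the edge `(x, x)` is a conjugate of `e_x`, namely `e_{x₀}`.
      have h : loop p hp x (gen x) = genStab x₀ := by
        apply Subtype.ext
        change p x * gen x * (p (act x (gen x)))⁻¹ = gen x₀
        rw [act_gen, star, Quandle.fix, mul_inv_eq_iff_eq_mul, gen_mul, hp]
      simp [E, f, h, hd]
  refine ⟨(quandleB2 X).liftQ E hE, fun h => ?_⟩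
  have key (a : As X) (x : X) : (quandleB2 X).liftQ E hE (pathClass x a) = f x a := by
    have f_one (x : X) : f x 1 = 0 := by simpa using f_mul x 1 1
    induction a using As.induction generalizing x with
    | hgen y => simp [E]
    | hone => rw [pathClass_one, map_zero, f_one]
    | hmul a b ha hb => rw [pathClass_mul, map_add, ha, hb, f_mul]
    | hinv a ha =>
      have h := f_mul x a⁻¹ a
      rw [inv_mul_cancel, f_one] at h
      rw [pathClass_inv, map_neg, ha, eq_neg_of_add_eq_zero_left h.symm]
  rw [key]
  have hloop : loop p hp x₀ h = ⟨p x₀, mem_stabAs.2 (hp x₀)⟩ * h *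
      (⟨p x₀, mem_stabAs.2 (hp x₀)⟩ : stabAs x₀)⁻¹ := by
    apply Subtype.ext
    simp [loop, mem_stabAs.1 h.2]
  simp only [f, hloop, ofMul_mul, ofMul_inv, map_add, map_neg]
  abel

end Stabilizer

/-! ### Mutually inverse maps up to the type of the quandle -/

section Comparison

variable {X : Type u} [Quandle X]

/-- If all right translations have period `n`, then the path class on relative chains has an
inverse up to multiplication by `n`: in one order on relative cycles, in the other on
`H_2^Q(X; ℤ)`. The inverse is the homomorphism on the stabilizer of `x₀` obtained from a cochain
trivializing `n` times the tautological cocycle, corrected by a multiple of the degree so that it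
factors through quandle homology. -/
theorem exists_inverse (hX : IsConnected X) (x₀ : X) {n : ℕ}
    (hn : ∀ x y : X, (fun z => star z y)^[n] x = x) {s : Inn X → As X}
    (hs : ∀ g, psi X (s g) = g) :
    ∃ D : ((X × X →₀ ℤ) ⧸ quandleB2 X) →ₗ[ℤ] RelChains (Stab x₀),
      (∀ r, relBoundary _ r = 0 → D (relPathClass hs x₀ r) = n • r) ∧
      (∀ q, chainBoundary q = 0 → relBoundary _ (D q) = 0) ∧
      ∀ q, chainBoundary q = 0 → relPathClass hs x₀ (D q) = n • q := by
  obtain ⟨c, hc⟩ := exists_cochain hX x₀ hn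
    { toFun := fun a b : As X => pairClass (Stab x₀) (psi X a) (psi X b)
      cocycle := fun a b c => by
        simpa only [map_mul] using pairClass_cocycle (psi X a) (psi X b) (psi X c) }
  simp only at hc
  have deg_one : deg (1 : As X) = 0 := by simp [deg]
  -- On `Stab x₀` the tautological cocycle is a coboundary, which makes `c` a homomorphism there.
  let w (h : stabAs x₀) : RelChains (Stab x₀) := c h + n • pointClass (psiStab h)
  have w_mul (h k : stabAs x₀) : w (h * k) = w h + w k := by
    have H := pairClass_coe (psiStab h) (psiStab k)
    have H' := hc h k
    change c (h * k) = _ + n • pairClass _ (psiStab h : Inn X) (psiStab k : Inn X) at H'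
    have hk : psiStab (h * k) = psiStab h * psiStab k := Subtype.ext (map_mul (psi X) _ _)
    simp only [w, Subgroup.coe_mul, H', H, hk, smul_add, smul_sub]
    abel
  let d : Additive (stabAs x₀) →+ RelChains (Stab x₀) :=
    AddMonoidHom.mk' (fun h => w h.toMul - deg (h.toMul : As X) • w (genStab x₀)) fun h k => by
      simp only [toMul_add, w_mul, Subgroup.coe_mul, deg_mul, add_smul]
      abel
  have d_apply (h : stabAs x₀) :
      d (Additive.ofMul h) = w h - deg (h : As X) • w (genStab x₀) := rfl
  have d_gen : d (Additive.ofMul (genStab x₀)) = 0 := by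
    simp [d_apply, genStab]
  obtain ⟨D, hD⟩ := exists_factor_pathClass hX x₀ d d_gen
  refine ⟨D, ?_, ?_, ?_⟩
  · -- The two sides differ by a map that factors through the boundary.
    let γ : (Inn X →₀ ℤ) →ₗ[ℤ] RelChains (Stab x₀) :=
      linearCombination ℤ fun g => c (s g) - deg (s g) • w (genStab x₀)
    have key : D ∘ₗ relPathClass hs x₀ = n • LinearMap.id + γ ∘ₗ relBoundary _ := by
      refine relChains_hom_ext (fun g h => ?_) fun k => ?_
      · let f : stabAs x₀ := ⟨factorSet s g h, mem_stabAs.2 (act_factorSet hs _ _ _)⟩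
        have hf : psiStab f = 1 := Subtype.ext (psi_factorSet hs g h)
        have h₁ := hc (s g) (s h)
        have h₂ := hc (factorSet s g h) (s (g * h))
        have h₃ := deg_mul (factorSet s g h) (s (g * h))
        rw [psi_factorSet hs, pairClass_one_left] at h₂
        have hfs : factorSet s g h * s (g * h) = s g * s h := by simp [factorSet]
        rw [hfs, h₁, hs, hs] at h₂
        rw [hfs, deg_mul] at h₃
        have h₄ : w f = c (s g) + c (s h) + n • pairClass _ g h - c (s (g * h)) := by
          simp only [w, hf]
          rw [h₂]
          simp only [f]
          abel
        have h₅ : deg (f : As X) = deg (s g) + deg (s h) - deg (s (g * h)) := by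
          rw [h₃]
          simp [f]
        have h₆ : D (relPathClass hs x₀ (pairClass _ g h)) = d (Additive.ofMul f) := by
          rw [relPathClass_pairClass, ← hD]
        simp only [LinearMap.comp_apply, LinearMap.add_apply, LinearMap.smul_apply,
          LinearMap.id_apply, h₆, d_apply, h₄, h₅, relBoundary_pairClass, map_add, map_sub, γ,
          linearCombination_single, one_smul, add_smul, sub_smul]
        abel
      · let f : stabAs x₀ := ⟨s k, mem_stabAs.2 (act_section hs k)⟩
        have hf : psiStab f = k := Subtype.ext (hs k)
        have h₆ : D (relPathClass hs x₀ (pointClass k)) = d (Additive.ofMul f) := by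
          rw [relPathClass_pointClass, ← hD]
        simp only [LinearMap.comp_apply, LinearMap.add_apply, LinearMap.smul_apply,
          LinearMap.id_apply, h₆, d_apply, w, hf, relBoundary_pointClass, γ,
          linearCombination_single, one_smul]
        abel
    intro r hr
    simpa [hr] using LinearMap.congr_fun key r
  · intro q hq
    obtain ⟨h, rfl⟩ := exists_pathClass_eq hX x₀ hq
    -- On the stabilizer this additive function computes the boundary of `w`.
    have H (a : As X) := eq_deg_smul hX x₀
      (fun a => relBoundary _ (c a) + n • single (psi X a) (1 : ℤ)) (fun a b => by
        simp only [hc, map_add, map_nsmul, relBoundary_pairClass, map_mul, smul_add, smul_sub]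
        abel) a
    have hw (h : stabAs x₀) : relBoundary _ (w h) =
        relBoundary _ (c h) + n • single (psi X (h : As X)) (1 : ℤ) := by
      simp only [w, map_add, map_nsmul, relBoundary_pointClass]
      rfl
    rw [hD, d_apply, map_sub, map_smul, hw, hw, H h, sub_eq_zero]
    rfl
  · intro q hq
    obtain ⟨h, rfl⟩ := exists_pathClass_eq hX x₀ hq
    -- The central part of `a` with respect to the section `s`.
    let k (a : As X) : As X := a * (s (psi X a))⁻¹
    have hk (a : As X) : psi X (k a) = 1 := by simp [k, hs]
    have k_mul (a b : As X) : k (a * b) = k a * (k b * factorSet s (psi X a) (psi X b)) := by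
      rw [← mul_assoc, ← mul_left_inj (s (psi X (a * b)))]
      rw [map_mul, mul_assoc (k a * k b), factorSet, inv_mul_cancel_right]
      rw [mul_assoc (k a), ← mul_assoc (k b), commute_of_psi_eq_one (hk b)]
      simp [k, mul_assoc]
    have H (a : As X) := eq_deg_smul hX x₀
      (fun a => relPathClass hs x₀ (c a) - n • pathClass x₀ (k a)) (fun a b => by
        simp only [hc, map_add, map_nsmul, relPathClass_pairClass, k_mul,
          pathClass_mul_of_act_eq (act_of_psi_eq_one (hk _) x₀), smul_add]
        abel) a
    have hw (h : stabAs x₀) : relPathClass hs x₀ (w h) =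
        relPathClass hs x₀ (c h) - n • pathClass x₀ (k h) + n • pathClass x₀ (h : As X) := by
      have h₁ : k h * s (psi X (h : As X)) = h := by simp [k]
      have h₂ := pathClass_mul_of_act_eq (act_of_psi_eq_one (hk h) x₀) (s (psi X (h : As X)))
      rw [h₁] at h₂
      rw [h₂]
      simp only [w, map_add, map_nsmul, relPathClass_pointClass, smul_add]
      simp only [psiStab]
      abel
    have hgen : ((genStab x₀ : stabAs x₀) : As X) = gen x₀ := rfl
    rw [hD, d_apply, map_sub, map_smul, hw, hw, H h, hgen, pathClass_gen_self, smul_zero,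
      add_zero, add_sub_cancel_left]

end Comparison

/-! ### Localization -/

section Localization

/-- Maps that are mutually inverse up to multiplication by an element of `S` become isomorphisms
after localization at `S`. -/
lemma bijective_localizedModule_map {R M N : Type*} [CommRing R] [AddCommGroup M] [Module R M]
    [AddCommGroup N] [Module R N] (S : Submonoid R) (t : S) (f : M →ₗ[R] N) (g : N →ₗ[R] M)
    (hgf : ∀ x, g (f x) = (t : R) • x) (hfg : ∀ y, f (g y) = (t : R) • y) :
    Function.Bijective (LocalizedModule.map S f) := by
  constructor
  · rw [← LinearMap.ker_eq_bot, LinearMap.ker_eq_bot']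
    intro x hx
    induction x using LocalizedModule.induction_on with
    | h x m =>
      rw [LocalizedModule.map_mk, ← LocalizedModule.zero_mk 1, LocalizedModule.mk_eq] at hx
      obtain ⟨v, hv⟩ := hx
      rw [← LocalizedModule.zero_mk 1, LocalizedModule.mk_eq]
      refine ⟨v * t, ?_⟩
      have h := congrArg g hv
      simp only [one_smul, smul_zero, map_zero, Submonoid.smul_def, map_smul, hgf] at h
      simp [Submonoid.smul_def, mul_smul, h]
  · intro y
    induction y using LocalizedModule.induction_on with
    | h y m =>
      refine ⟨LocalizedModule.mk (g y) (t * m), ?_⟩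
      rw [LocalizedModule.map_mk, hfg]
      exact LocalizedModule.mk_cancel_common_left t m y

lemma exists_localizedModule_equiv {R M N : Type*} [CommRing R] [AddCommGroup M] [Module R M]
    [AddCommGroup N] [Module R N] (S : Submonoid R) (t : S) (f : M →ₗ[R] N) (g : N →ₗ[R] M)
    (hgf : ∀ x, g (f x) = (t : R) • x) (hfg : ∀ y, f (g y) = (t : R) • y) :
    ∃ e : LocalizedModule S M ≃ₗ[Localization S] LocalizedModule S N,
      ∀ x m, e (LocalizedModule.mk x m) = LocalizedModule.mk (f x) m :=
  ⟨LinearEquiv.ofBijective _ (bijective_localizedModule_map S t f g hgf hfg), fun x m => by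
    rw [LinearEquiv.ofBijective_apply, LocalizedModule.map_mk]⟩

lemma natCast_mem_primeCompl {ℓ n : ℕ} [Fact ℓ.Prime] (h : Nat.Coprime ℓ n) :
    (n : ℤ) ∈ primeCompl ℓ := by
  change (n : ℤ) ∉ Ideal.span {(ℓ : ℤ)}
  rw [Ideal.mem_span_singleton, Int.natCast_dvd_natCast]
  exact (Nat.Prime.coprime_iff_not_dvd Fact.out).1 h

lemma iterate_eq_of_quandleType_eq {X : Type u} [Quandle X] {n : ℕ} (h : quandleType X = n) :
    ∀ x y : X, (fun z => star z y)^[n] x = x := by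
  have hlt : quandleType X < ⊤ := h ▸ ENat.natCast_lt_top n
  rw [quandleType] at h hlt
  simp only [iInf_lt_iff] at hlt
  obtain ⟨m, hm, -⟩ := hlt
  let P (m : ℕ) : Prop := 0 < m ∧ ∀ x y : X, (fun z => star z y)^[m] x = x
  have hP : ∃ m, P m := ⟨m, hm⟩
  classical
  have hfind : (⨅ (m : ℕ) (_ : P m), (m : ℕ∞)) = Nat.find hP :=
    le_antisymm (iInf₂_le _ (Nat.find_spec hP))
      (le_iInf₂ fun k hk => Nat.cast_le.2 (Nat.find_min' hP hk))
  have hn : n = Nat.find hP := Nat.cast_injective (h.symm.trans hfind)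
  rw [hn]
  exact (Nat.find_spec hP).2

/-- A linear map whose values lie in the range of an injective map `ι` factors through `ι`. -/
lemma exists_lift_of_range_le {M N P : Type*} [AddCommGroup M] [AddCommGroup N] [AddCommGroup P]
    {ι : N →ₗ[ℤ] P} (hι : Function.Injective ι) (f : M →ₗ[ℤ] P)
    (hf : ∀ x, f x ∈ LinearMap.range ι) : ∃ g : M →ₗ[ℤ] N, ∀ x, ι (g x) = f x := by
  refine ⟨(LinearEquiv.ofInjective ι hι).symm ∘ₗ f.codRestrict _ hf, fun x => ?_⟩
  have h := LinearEquiv.apply_symm_apply (LinearEquiv.ofInjective ι hι) (f.codRestrict _ hf x)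
  exact congrArg Subtype.val h

lemma comp_eq_smul_of_lift {M N P Q : Type*} [AddCommGroup M] [AddCommGroup N] [AddCommGroup P]
    [AddCommGroup Q] {ι : M →ₗ[ℤ] P} {κ : N →ₗ[ℤ] Q} (hι : Function.Injective ι)
    {f : P →ₗ[ℤ] Q} {g : Q →ₗ[ℤ] P} {f' : M →ₗ[ℤ] N} {g' : N →ₗ[ℤ] M}
    (hf : ∀ x, κ (f' x) = (f ∘ₗ ι) x) (hg : ∀ y, ι (g' y) = (g ∘ₗ κ) y) {n : ℕ}
    (h : ∀ x, g (f (ι x)) = n • ι x) (x : M) : g' (f' x) = (n : ℤ) • x := by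
  apply hι
  rw [hg, LinearMap.comp_apply, hf, LinearMap.comp_apply, h, map_smul, natCast_zsmul]

end Localization

section Extension

variable {X : Type u} [Quandle X]

/-- The homomorphism `𝒯_*` extends, though not canonically, to all of
`H_2(Inn X, Stab x₀; ℤ)`, and if all right translations have period `n`, then the extension has an
inverse up to multiplication by `n`. -/
theorem exists_transgression (hX : IsConnected X) (x₀ : X) :
    ∃ F : H2Rel (Stab x₀) →ₗ[ℤ] H2Q X,
      IsTransgression x₀ (F ∘ₗ (LinearMap.ker (connecting (Stab x₀))).subtype) ∧
      ∀ n : ℕ, (∀ x y : X, (fun z => star z y)^[n] x = x) →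
        ∃ B : H2Q X →ₗ[ℤ] H2Rel (Stab x₀),
          (∀ x, B (F x) = (n : ℤ) • x) ∧ ∀ y, F (B y) = (n : ℤ) • y := by
  choose s hs using psi_surjective (X := X)
  have hrel (x : H2Rel (Stab x₀)) : relBoundary _ (H2Rel.toChains _ x) = 0 :=
    (H2Rel.mem_range_toChains _).1 ⟨x, rfl⟩
  have hqua (y : H2Q X) : chainBoundary (H2Q.toChains X y) = 0 := mem_range_toChains.1 ⟨y, rfl⟩
  obtain ⟨F, hF⟩ := exists_lift_of_range_le toChains_injective
    (relPathClass hs x₀ ∘ₗ H2Rel.toChains (Stab x₀))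
    fun x => mem_range_toChains.2 (chainBoundary_relPathClass hs x₀ _)
  refine ⟨F, fun s' hs' z => ?_, fun n hn => ?_⟩
  · have h₁ : relPathClass hs x₀ (H2Rel.toChains _ (absToRel (Stab x₀) z)) =
        factorClass s x₀ z.1 +
          linearCombination ℤ (fun k : Stab x₀ => pathClass x₀ (s k)) 0 := rfl
    rw [map_zero, add_zero, factorClass_eq_of_mem_ker hs' hs x₀ z.2] at h₁
    exact (hF _).trans h₁
  · obtain ⟨D, hD₁, hD₂, hD₃⟩ := exists_inverse hX x₀ hn hs
    obtain ⟨B, hB⟩ := exists_lift_of_range_le (H2Rel.toChains_injective (Stab x₀))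
      (D ∘ₗ H2Q.toChains X) fun y => (H2Rel.mem_range_toChains _).2 (hD₂ _ (hqua y))
    exact ⟨B, comp_eq_smul_of_lift (H2Rel.toChains_injective (Stab x₀)) hF hB
      fun x => hD₁ _ (hrel x),
      comp_eq_smul_of_lift toChains_injective hB hF fun y => hD₃ _ (hqua y)⟩

end Extension

end QuandleSchur

end

open QuandleSchur in
theorem theorem3p3 {X : Type*} [Quandle X] (hX : QuandleSchur.IsConnected X) (x₀ : X) :
    ∃ T : LinearMap.ker (QuandleSchur.connecting (QuandleSchur.Stab x₀)) →ₗ[ℤ]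
        QuandleSchur.H2Q X,
      QuandleSchur.IsTransgression x₀ T ∧
      ∀ (ℓ : ℕ) [Fact ℓ.Prime],
        (∃ n : ℕ, QuandleSchur.quandleType X = n ∧ Nat.Coprime ℓ n) →
        Subsingleton (LocalizedModule (QuandleSchur.primeCompl ℓ)
          (QuandleSchur.H1 (QuandleSchur.Stab x₀))) →
        ∃ e : LocalizedModule (QuandleSchur.primeCompl ℓ)
              (QuandleSchur.H2Rel (QuandleSchur.Stab x₀))
            ≃ₗ[Localization (QuandleSchur.primeCompl ℓ)]
            LocalizedModule (QuandleSchur.primeCompl ℓ) (QuandleSchur.H2Q X),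
          ∀ (c : LinearMap.ker (QuandleSchur.connecting (QuandleSchur.Stab x₀)))
            (m : QuandleSchur.primeCompl ℓ),
            e (LocalizedModule.mk (c : QuandleSchur.H2Rel (QuandleSchur.Stab x₀)) m) =
              LocalizedModule.mk (T c) m := by
  obtain ⟨F, hF, h⟩ := exists_transgression hX x₀
  refine ⟨F ∘ₗ Submodule.subtype _, hF, ?_⟩
  rintro ℓ _ ⟨n, hn, hℓ⟩ -
  obtain ⟨B, hBF, hFB⟩ := h n (iterate_eq_of_quandleType_eq hn)
  obtain ⟨e, he⟩ := exists_localizedModule_equiv (primeCompl ℓ)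
    ⟨n, natCast_mem_primeCompl hℓ⟩ F B hBF hFB
  exact ⟨e, fun c m => he c m⟩
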